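/- For $n\ge 1$ let $\mathfrak S_n$ be the set of permutations of $\{1,\dots,n\}$. Say that a function $f$ defined on $\bigcup_{n\ge1}\mathfrak S_n$ with values in some $\mathbb R^d$ (with its Euclidean norm $|\cdot|$) satisfies $(\mathcal H'1)$ if $$\sup_{n\ge 1}\ \sup_{\sigma\in\mathfrak S_n}\ \sup_{1\le i,j\le n} |f(\sigma)-f(\sigma\circ(i,j))|<+\infty ,$$ where $(i,j)$ is the transposition of $i$ and $j$ (the identity if $i=j$). Then each of the following functions of $\sigma\in\mathfrak S_n$ satisfies $(\mathcal H'1)$: 1. $\mathrm{LIS}(\sigma)$, the length of the longest increasing subsequence of $(\sigma(1),\dots,\sigma(n))$; 2. $\mathrm{LDS}(\sigma)$, the length of the longest decreasing subsequence; 3. for every fixed integer $d\ge 0$, the vector $(\lambda_1(\sigma),\dots,\lambda_d(\sigma))$, where $\lambda_i(\sigma)$ is the length of the $i$-th row of the tableau obtained by inserting $\sigma(1),\dots,\sigma(n)$ successively by Robinson–Schensted (RSK) row insertion ($\lambda_i(\sigma)=0$ if there is no $i$-th row); 4. $\mathrm{Inv}(\sigma)/n$, where $\mathrm{Inv}(\sigma)=\mathrm{card}\{(i,j):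 i<j,\ \sigma(i)>\sigma(j)\}$; 5. the descent count $D(\sigma)=\mathrm{card}\{1\le i\le n-1:\ \sigma(i+1)<\sigma(i)\}$; 6. the ascent count $A(\sigma)=\mathrm{card}\{1\le i\le n-1:\ \sigma(i+1)>\sigma(i)\}$; 7. the peak count $\mathrm{Peaks}(\sigma)=\mathrm{card}\{1<i<n:\ \sigma(i-1)<\sigma(i)>\sigma(i+1)\}$; 8. the valley count $\mathrm{Valleys}(\sigma)=\mathrm{card}\{1<i<n:\ \sigma(i-1)>\sigma(i)<\sigma(i+1)\}$; 9. the exceedance count $\mathrm{Exc}(\sigma)=\mathrm{card}\{i:\ \sigma(i)>i\}$; 10. $\mathrm{Maj}(\sigma)/n$, where $\mathrm{Maj}(\sigma)=\sum_{1\le i\le n-1,\ \sigma(i+1)>\sigma(i)} i$; 11. $\mathrm{LAS}(\sigma)$, the largest $k$ for which there are $1\le i_1<\dots<i_k\le n$ with $\sigma(i_1)<\sigma(i_2)>\sigma(i_3)<\sigma(i_4)>\cdots$ (the length of the longest alternating subsequence). -/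

import Mathlib

namespace PermStat

open Equiv

/-- A permutation statistic `f`, defined on permutations of all sizes with values in a normed space,
satisfies `∃ C, |f(σ) - f(σ ∘ (i, j))| ≤ C` uniformly in the size `n ≥ 1`, in `σ` and in `i, j`,
that is, the supremum of all these quantities is finite. -/
def TranspositionBounded {E : Type*} [NormedAddCommGroup E]
    (f : (n : ℕ) → Perm (Fin n) → E) : Prop :=
  ∃ C : ℝ, ∀ n : ℕ, 1 ≤ n → ∀ (σ : Perm (Fin n)) (i j : Fin n),
    ‖f n σ - f n (σ * swap i j)‖ ≤ C

variable {n : ℕ}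

/-! ### Longest monotone and alternating subsequences

A subsequence of length `k` of `σ` is given by its positions, a strictly increasing map
`p : Fin k → Fin n`. All the suprema below are maxima of nonempty sets bounded by `n`. -/

/-- A subsequence of a word of length `n` has length at most `n`. -/
theorem length_le_of_strictMono {k : ℕ} {p : Fin k → Fin n} (hp : StrictMono p) : k ≤ n := by
  simpa using Fintype.card_le_of_injective p hp.injective

/-- Length of the longest increasing subsequence. -/
noncomputable def LIS (σ : Perm (Fin n)) : ℕ :=
  sSup {k : ℕ | ∃ p : Fin k → Fin n, StrictMono p ∧ StrictMono (fun m => σ (p m))}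

/-- Length of the longest decreasing subsequence. -/
noncomputable def LDS (σ : Perm (Fin n)) : ℕ :=
  sSup {k : ℕ | ∃ p : Fin k → Fin n, StrictMono p ∧ StrictAnti (fun m => σ (p m))}

/-- The word `a 0, a 1, …, a (k - 1)` satisfies `a 0 < a 1 > a 2 < a 3 > ⋯`. -/
def IsAlternating {k : ℕ} (a : Fin k → Fin n) : Prop :=
  ∀ (m : ℕ) (h : m + 1 < k),
    (Even m → a ⟨m, Nat.lt_of_succ_lt h⟩ < a ⟨m + 1, h⟩) ∧
    (Odd m → a ⟨m + 1, h⟩ < a ⟨m, Nat.lt_of_succ_lt h⟩)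

/-- Length of the longest alternating subsequence. -/
noncomputable def LAS (σ : Perm (Fin n)) : ℕ :=
  sSup {k : ℕ | ∃ p : Fin k → Fin n, StrictMono p ∧ IsAlternating (fun m => σ (p m))}

/-! ### The Robinson–Schensted shape, by row insertion -/

/-- Insert `x` into a row: `x` replaces the leftmost entry larger than `x`, and that entry is
bumped (returned as `some y`); if there is none, `x` is appended at the end of the row. -/
def rowInsert {α : Type*} [LinearOrder α] (x : α) : List α → List α × Option α
  | [] => ([x], none)
  | y :: r => if x < y then (x :: r, some y) else (y :: (rowInsert x r).1, (rowInsert x r).2)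

/-- Insert `x` into a tableau (the list of its rows, from the first row on): insert `x` into the
first row and, if an entry is bumped, insert this entry into the tableau of the remaining rows. -/
def tableauInsert {α : Type*} [LinearOrder α] : List (List α) → α → List (List α)
  | [], x => [[x]]
  | r :: T, x =>
    match rowInsert x r with
    | (r', none) => r' :: T
    | (r', some y) => r' :: tableauInsert T y

/-- The insertion tableau of `σ`: insert `σ(1), σ(2), …, σ(n)` successively, starting from the
empty tableau. -/
def insertionTableau (σ : Perm (Fin n)) : List (List (Fin n)) :=
  (List.ofFn fun i => σ i).foldl tableauInsert []

/-- Length of the row with index `i` (starting from `0`) of the Robinson–Schensted shape of `σ`;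
it is `0` if there is no such row. -/
def rskRow (σ : Perm (Fin n)) (i : ℕ) : ℕ :=
  ((insertionTableau σ).getD i []).length

/-- The vector of the first `d` row lengths of the Robinson–Schensted shape of `σ`, in Euclidean
space. -/
noncomputable def rskRows (d : ℕ) (σ : Perm (Fin n)) : EuclideanSpace ℝ (Fin d) :=
  WithLp.toLp 2 fun i => (rskRow σ i : ℝ)

/-! ### Counting statistics -/

/-- Number of inversions. -/
def Inv (σ : Perm (Fin n)) : ℕ :=
  (Finset.univ.filter fun p : Fin n × Fin n => p.1 < p.2 ∧ σ p.2 < σ p.1).card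

/-- Position `i` is a descent: `σ(i + 1) < σ(i)`. -/
def IsDescent (σ : Perm (Fin n)) (i : Fin n) : Prop :=
  ∃ h : (i : ℕ) + 1 < n, σ ⟨i + 1, h⟩ < σ i

/-- Position `i` is an ascent: `σ(i + 1) > σ(i)`. -/
def IsAscent (σ : Perm (Fin n)) (i : Fin n) : Prop :=
  ∃ h : (i : ℕ) + 1 < n, σ i < σ ⟨i + 1, h⟩

/-- Position `i` is a peak: `σ(i - 1) < σ(i) > σ(i + 1)`, both neighbours being positions. -/
def IsPeak (σ : Perm (Fin n)) (i : Fin n) : Prop :=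
  ∃ (_ : 0 < (i : ℕ)) (h : (i : ℕ) + 1 < n),
    σ ⟨i - 1, lt_of_le_of_lt (Nat.sub_le _ _) i.isLt⟩ < σ i ∧ σ ⟨i + 1, h⟩ < σ i

/-- Position `i` is a valley: `σ(i - 1) > σ(i) < σ(i + 1)`, both neighbours being positions. -/
def IsValley (σ : Perm (Fin n)) (i : Fin n) : Prop :=
  ∃ (_ : 0 < (i : ℕ)) (h : (i : ℕ) + 1 < n),
    σ i < σ ⟨i - 1, lt_of_le_of_lt (Nat.sub_le _ _) i.isLt⟩ ∧ σ i < σ ⟨i + 1, h⟩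

instance (σ : Perm (Fin n)) : DecidablePred (IsDescent σ) := fun _ => by
  unfold IsDescent; infer_instance

instance (σ : Perm (Fin n)) : DecidablePred (IsAscent σ) := fun _ => by
  unfold IsAscent; infer_instance

instance (σ : Perm (Fin n)) : DecidablePred (IsPeak σ) := fun _ => by
  unfold IsPeak; infer_instance

instance (σ : Perm (Fin n)) : DecidablePred (IsValley σ) := fun _ => by
  unfold IsValley; infer_instance

/-- Number of descents. -/
def Des (σ : Perm (Fin n)) : ℕ := (Finset.univ.filter (IsDescent σ)).card

/-- Number of ascents. -/
def Asc (σ : Perm (Fin n)) : ℕ := (Finset.univ.filter (IsAscent σ)).card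

/-- Number of peaks. -/
def Peaks (σ : Perm (Fin n)) : ℕ := (Finset.univ.filter (IsPeak σ)).card

/-- Number of valleys. -/
def Valleys (σ : Perm (Fin n)) : ℕ := (Finset.univ.filter (IsValley σ)).card

/-- Number of exceedances, `σ(i) > i`. -/
def Exc (σ : Perm (Fin n)) : ℕ := (Finset.univ.filter fun i : Fin n => i < σ i).card

/-- Major index, with the convention `Maj(σ) = ∑ i` over the positions `i ∈ {1, …, n - 1}` with
`σ(i + 1) > σ(i)`. The element `i : Fin n` stands for the position `i + 1`. -/
def Maj (σ : Perm (Fin n)) : ℕ := ∑ i ∈ Finset.univ.filter (IsAscent σ), ((i : ℕ) + 1)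

end PermStat

/-!
The argument rests on three mechanisms.

*Longest subsequences.* The word of `σ * swap i j` arises from the word of `σ` by changing two
letters, so a function of words that moves by at most `c` when one letter is changed moves by at
most `2 * c` under a transposition (`abs_sub_mul_swap_le`). The length of the longest subword with
a property `Q` has such a bound as soon as the loss of one letter of a word with property `Q` can be
repaired by deleting boundedly many letters (`abs_maxSubword_sub_le`). For monotone words nothing
has to be repaired; in an alternating word that loses an interior letter `x`, the neighbour of `x`
that lies closer to it in value is deleted too (`Alternates.exists_sublist`).

*Counting statistics.* A transposition affects at most six positions for the local statistics, at
most six terms, each at most `n`, for the major index, and at most `4 * n` pairs for the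
inversions.

*Row lengths of the Robinson–Schensted shape.* By Greene's theorem (`isGreatest_rowSum`),
`λ₁ + ⋯ + λₖ` is the largest total length of `k` disjoint increasing subsequences, so changing one
letter moves it by at most `1`, and each `λᵢ` is a difference of two such sums. Greene's theorem is
proved for arbitrary words and weakly increasing subsequences. A family of `k` disjoint increasing
subsequences is encoded by the process that reads the word and keeps the last letter of each of them
(`Chains`). The possible total lengths are invariant under Knuth relations, by an exchange of the
tails of two subsequences (`chainEquiv_knuth_left`, `chainEquiv_knuth_right`), hence
under the replacement of a word by the reading word of its insertion tableau
(`chainEquiv_foldl_tableauInsert`). In the reading word of a tableau the first `k` rows are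
increasing subsequences, while an increasing subsequence meets each column, whose entries decrease,
at most once (`Chains.le_sum_min`).
-/

namespace PermStat

open Equiv

/-! ### Words of permutations and changes of one letter -/

theorem ofFn_mul_swap {n : ℕ} (σ : Perm (Fin n)) (i j : Fin n) :
    (List.ofFn fun m => (σ * swap i j) m) =
      ((List.ofFn fun m => σ m).set i (σ j)).set j (σ i) := by
  refine List.ext_getElem (by simp) fun m h₁ h₂ => ?_
  have hm : m < n := by simpa using h₁
  simp only [List.getElem_ofFn, List.getElem_set, Perm.coe_mul, Function.comp_apply,
    swap_apply_def, Fin.ext_iff]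
  by_cases hj : m = j
  · subst hj
    by_cases hi : (j : ℕ) = i
    · simp [Fin.ext hi]
    · simp [hi]
  · by_cases hi : m = i
    · subst hi; simp [Ne.symm hj]
    · simp [hi, hj, Ne.symm hi, Ne.symm hj]

/-- A function of words that moves by at most `c` when one letter is changed gives a statistic of
permutations that moves by at most `2 * c` under a transposition. -/
theorem abs_sub_mul_swap_le {n : ℕ} {f : List (Fin n) → ℝ} {c : ℝ}
    (hf : ∀ A x y B, |f (A ++ x :: B) - f (A ++ y :: B)| ≤ c) (σ : Perm (Fin n)) (i j : Fin n) :
    |f (List.ofFn fun m => σ m) - f (List.ofFn fun m => (σ * swap i j) m)| ≤ 2 * c := by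
  have key : ∀ (w : List (Fin n)) (m : ℕ) (y : Fin n), m < w.length →
      |f w - f (w.set m y)| ≤ c := by
    intro w m y hm
    have h := hf (w.take m) w[m] y (w.drop (m + 1))
    rw [List.set_eq_take_append_cons_drop, if_pos hm]
    rwa [← List.drop_eq_getElem_cons hm, List.take_append_drop] at h
  rw [ofFn_mul_swap]
  have h₁ := key (List.ofFn fun m => σ m) i (σ j) (by simp)
  have h₂ := key ((List.ofFn fun m => σ m).set i (σ j)) j (σ i) (by simp)
  have := abs_sub_le (f (List.ofFn fun m => σ m)) (f ((List.ofFn fun m => σ m).set i (σ j)))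
    (f (((List.ofFn fun m => σ m).set i (σ j)).set j (σ i)))
  linarith

/-! ### Longest subwords with a given property -/

/-- The largest length of a subword of `w` with property `Q`. -/
noncomputable def maxSubword {α : Type*} (Q : List α → Prop) (w : List α) : ℕ :=
  sSup {k : ℕ | ∃ l : List α, l.Sublist w ∧ Q l ∧ l.length = k}

theorem bddAbove_subword {α : Type*} (Q : List α → Prop) (w : List α) :
    BddAbove {k : ℕ | ∃ l : List α, l.Sublist w ∧ Q l ∧ l.length = k} :=
  ⟨w.length, by rintro _ ⟨l, h, -, rfl⟩; exact h.length_le⟩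

/-- If the loss of one letter of a word with property `Q` can be repaired by the loss of at most `c`
letters in all, then changing one letter of `w` moves `maxSubword Q w` by at most `c`. -/
theorem abs_maxSubword_sub_le {α : Type*} {Q : List α → Prop} {c : ℕ} (h0 : Q [])
    (hQ : ∀ A x B, Q (A ++ x :: B) →
      ∃ l : List α, l.Sublist (A ++ B) ∧ Q l ∧ (A ++ x :: B).length ≤ l.length + c)
    (A : List α) (x y : α) (B : List α) :
    |(maxSubword Q (A ++ x :: B) : ℝ) - maxSubword Q (A ++ y :: B)| ≤ c := by
  have key : ∀ x y, maxSubword Q (A ++ x :: B) ≤ maxSubword Q (A ++ y :: B) + c := by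
    intro x y
    refine csSup_le ⟨0, [], by simp, h0, rfl⟩ ?_
    rintro _ ⟨l, hl, hQl, rfl⟩
    obtain ⟨l₁, l₂, rfl, h₁, h₂⟩ := List.sublist_append_iff.1 hl
    have hsub : ∀ l' : List α, l'.Sublist (A ++ B) → l'.Sublist (A ++ y :: B) := fun l' h =>
      h.trans ((List.Sublist.refl A).append (List.sublist_cons_self y B))
    rcases List.sublist_cons_iff.1 h₂ with h₂ | ⟨r, rfl, hr⟩
    · exact (le_csSup (bddAbove_subword Q _) ⟨_, hsub _ (h₁.append h₂), hQl, rfl⟩).trans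
        (Nat.le_add_right _ _)
    · obtain ⟨l', hl', hQ', hlen⟩ := hQ _ _ _ hQl
      refine hlen.trans (Nat.add_le_add_right ?_ c)
      exact le_csSup (bddAbove_subword Q _) ⟨l', hsub _ (hl'.trans (h₁.append hr)), hQ', rfl⟩
  rw [abs_sub_le_iff]
  constructor <;> rw [sub_le_iff_le_add'] <;> exact_mod_cast key _ _

theorem sSup_subsequence_eq {n : ℕ} {Q : List (Fin n) → Prop}
    {P : ∀ {k : ℕ}, (Fin k → Fin n) → Prop}
    (hPQ : ∀ {k : ℕ} (a : Fin k → Fin n), P a ↔ Q (List.ofFn a)) (σ : Perm (Fin n)) :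
    sSup {k : ℕ | ∃ p : Fin k → Fin n, StrictMono p ∧ P (fun m => σ (p m))} =
      maxSubword Q (List.ofFn fun m => σ m) := by
  unfold maxSubword
  congr 1
  ext k
  constructor
  · rintro ⟨p, hp, h⟩
    refine ⟨List.ofFn fun m => σ (p m), ?_, (hPQ _).1 h, by simp⟩
    rw [List.sublist_iff_exists_fin_orderEmbedding_get_eq]
    refine ⟨(Fin.castOrderIso (by simp)).toOrderEmbedding.trans
      ((OrderEmbedding.ofStrictMono p hp).trans
        (Fin.castOrderIso (by simp)).toOrderEmbedding), fun m => ?_⟩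
    simp only [List.get_eq_getElem, List.getElem_ofFn]
    rfl
  · rintro ⟨l, hl, hQ, rfl⟩
    obtain ⟨f, hf⟩ := List.sublist_iff_exists_fin_orderEmbedding_get_eq.1 hl
    refine ⟨fun m => Fin.cast (by simp) (f m), fun a b hab => by simpa using hab, ?_⟩
    rw [hPQ]
    convert hQ
    refine List.ext_getElem (by simp) fun m h₁ h₂ => ?_
    have := hf ⟨m, h₂⟩
    simp only [List.get_eq_getElem, List.getElem_ofFn] at this ⊢
    rw [this]
    rfl

theorem exists_sublist_of_pairwise {α : Type*} {R : α → α → Prop} (A : List α) (x : α) (B : List α)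
    (h : (A ++ x :: B).Pairwise R) :
    ∃ l : List α, l.Sublist (A ++ B) ∧ l.Pairwise R ∧ (A ++ x :: B).length ≤ l.length + 1 :=
  ⟨A ++ B, List.Sublist.refl _,
    h.sublist ((List.Sublist.refl A).append (List.sublist_cons_self x B)), by simp; omega⟩

/-! ### Alternating words -/

/-- The word alternates, starting with a rise if `b = true` and with a fall if `b = false`. -/
def Alternates {α : Type*} [LinearOrder α] : Bool → List α → Prop
  | _, [] => True
  | _, [_] => True
  | b, x :: y :: l => (if b then x < y else y < x) ∧ Alternates (!b) (y :: l)

theorem alternates_iff_getElem {α : Type*} [LinearOrder α] (b : Bool) (l : List α) :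
    Alternates b l ↔ ∀ (m : ℕ) (h : m + 1 < l.length),
      if (if Even m then b else !b) then l[m] < l[m + 1] else l[m + 1] < l[m] := by
  induction l generalizing b with
  | nil => simp [Alternates]
  | cons x l ih =>
    cases l with
    | nil => simp [Alternates]
    | cons y l =>
      rw [Alternates, ih]
      constructor
      · rintro ⟨h0, h⟩ (_ | m) hm
        · simpa using h0
        · have := h m (by simpa using hm)
          by_cases he : Even m <;> simpa [he, Nat.even_add_one] using this
      · intro h
        refine ⟨by simpa using h 0 (by simp), fun m hm => ?_⟩
        have := h (m + 1) (by simpa using hm)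
        by_cases he : Even m <;> simpa [he, Nat.even_add_one] using this

theorem isAlternating_iff_alternates {n k : ℕ} (a : Fin k → Fin n) :
    IsAlternating a ↔ Alternates true (List.ofFn a) := by
  rw [alternates_iff_getElem, IsAlternating]
  refine ⟨fun h m hm => ?_, fun h m hm => ?_⟩
  · have := h m (by simpa using hm)
    by_cases he : Even m <;> simp [he] <;> simp_all
  · have := h m (by simpa using hm)
    by_cases he : Even m <;> simp_all

/-- Deleting an interior letter `x` of an alternating word: of the two neighbours of `x`, the one
that lies farther from `x` is kept and the other one is deleted as well. When the neighbour on the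
left is the first letter, it may thus be replaced by a letter that lies farther from what precedes
it, which is what the induction needs. -/
theorem Alternates.exists_sublist_cons {α : Type*} [LinearOrder α] {x : α} {B : List α} :
    ∀ {A : List α} {b : Bool} {a : α}, Alternates b (a :: (A ++ x :: B)) →
      ∃ (a' : α) (l : List α), (a' :: l).Sublist (a :: (A ++ B)) ∧ Alternates b (a' :: l) ∧
        (if b then a' ≤ a else a ≤ a') ∧ (A ++ x :: B).length ≤ l.length + 2
  | [], b, a, h => by
    cases B with
    | nil => exact ⟨a, [], by simp, trivial, by simp, by simp⟩
    | cons c B =>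
      obtain ⟨h₁, h₂, h₃⟩ := h
      by_cases hc : if b then c ≤ a else a ≤ c
      · exact ⟨c, B, by simp, by simpa using h₃, hc, by simp⟩
      · refine ⟨a, B, by simp, ?_, by simp, by simp⟩
        cases B with
        | nil => trivial
        | cons d B =>
          obtain ⟨h₃, h₄⟩ := h₃
          refine ⟨?_, by simpa using h₄⟩
          cases b
          · simp at hc h₃ ⊢; exact h₃.trans hc
          · simp at hc h₃ ⊢; exact hc.trans h₃
  | e :: A, b, a, h => by
    obtain ⟨h₁, h₂⟩ := h
    obtain ⟨e', l, hs, ha, he, hl⟩ := Alternates.exists_sublist_cons h₂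
    refine ⟨a, e' :: l, hs.cons_cons a, ⟨?_, ha⟩, by simp, by simpa using hl⟩
    cases b
    · simp at h₁ he ⊢; exact he.trans_lt h₁
    · simp at h₁ he ⊢; exact h₁.trans_le he

theorem Alternates.exists_sublist {α : Type*} [LinearOrder α] {b : Bool} (A : List α) (x : α)
    (B : List α) (h : Alternates b (A ++ x :: B)) :
    ∃ l : List α, l.Sublist (A ++ B) ∧ Alternates b l ∧ (A ++ x :: B).length ≤ l.length + 2 := by
  cases A with
  | nil =>
    -- To keep the direction of the first step, the letter after `x` is deleted too.
    match B, h with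
    | [], _ => exact ⟨[], by simp, trivial, by simp⟩
    | c :: B, ⟨_, h⟩ =>
      refine ⟨B, by simp, ?_, by simp⟩
      cases B with
      | nil => trivial
      | cons d B => simpa using h.2
  | cons a A =>
    obtain ⟨a', l, hs, ha, -, hl⟩ := Alternates.exists_sublist_cons h
    exact ⟨a' :: l, hs, ha, by simpa using hl⟩

theorem transpositionBounded_LIS : TranspositionBounded (fun _ σ => (LIS σ : ℝ)) := by
  refine ⟨2 * (1 : ℕ), fun n _ σ i j => ?_⟩
  have h := abs_sub_mul_swap_le (f := fun w => (maxSubword (List.Pairwise (· < ·)) w : ℝ))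
    (abs_maxSubword_sub_le (Q := List.Pairwise (· < ·)) (c := 1)
    List.Pairwise.nil exists_sublist_of_pairwise) σ i j
  rw [Real.norm_eq_abs]
  have e : ∀ τ : Perm (Fin n), LIS τ = maxSubword (List.Pairwise (· < ·))
      (List.ofFn fun m => τ m) := sSup_subsequence_eq (P := StrictMono) (fun a => by
        simp [List.pairwise_ofFn, StrictMono])
  simpa only [e] using h

theorem transpositionBounded_LDS : TranspositionBounded (fun _ σ => (LDS σ : ℝ)) := by
  refine ⟨2 * (1 : ℕ), fun n _ σ i j => ?_⟩
  have h := abs_sub_mul_swap_le (f := fun w => (maxSubword (List.Pairwise (· > ·)) w : ℝ))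
    (abs_maxSubword_sub_le (Q := List.Pairwise (· > ·)) (c := 1)
    List.Pairwise.nil exists_sublist_of_pairwise) σ i j
  rw [Real.norm_eq_abs]
  have e : ∀ τ : Perm (Fin n), LDS τ = maxSubword (List.Pairwise (· > ·))
      (List.ofFn fun m => τ m) := sSup_subsequence_eq (P := StrictAnti) (fun a => by
        simp [List.pairwise_ofFn, StrictAnti])
  simpa only [e] using h

theorem transpositionBounded_LAS : TranspositionBounded (fun _ σ => (LAS σ : ℝ)) := by
  refine ⟨2 * (2 : ℕ), fun n _ σ i j => ?_⟩
  have h := abs_sub_mul_swap_le (f := fun w => (maxSubword (Alternates true) w : ℝ))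
    (abs_maxSubword_sub_le (Q := Alternates true) (c := 2)
    trivial Alternates.exists_sublist) σ i j
  rw [Real.norm_eq_abs]
  have e : ∀ τ : Perm (Fin n), LAS τ = maxSubword (Alternates true)
      (List.ofFn fun m => τ m) :=
    sSup_subsequence_eq (P := IsAlternating) isAlternating_iff_alternates
  simpa only [e] using h

/-! ### Counting statistics -/

theorem abs_sum_filter_sub_le {ι : Type*} [Fintype ι] [DecidableEq ι] (p q : ι → Prop)
    [DecidablePred p] [DecidablePred q] (g : ι → ℕ) (S : Finset ι)
    (h : ∀ i, i ∉ S → (p i ↔ q i)) :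
    |((∑ i ∈ Finset.univ.filter p, g i : ℕ) : ℝ) - (∑ i ∈ Finset.univ.filter q, g i : ℕ)| ≤
      (∑ i ∈ S, g i : ℕ) := by
  have key : ∀ (p q : ι → Prop) [DecidablePred p] [DecidablePred q],
      (∀ i, i ∉ S → (p i ↔ q i)) →
      ∑ i ∈ Finset.univ.filter p, g i ≤ ∑ i ∈ Finset.univ.filter q, g i + ∑ i ∈ S, g i := by
    intro p q _ _ h
    calc ∑ i ∈ Finset.univ.filter p, g i ≤ ∑ i ∈ Finset.univ.filter q ∪ S, g i := by
          refine Finset.sum_le_sum_of_subset fun i hi => ?_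
          by_cases hS : i ∈ S
          · simp [hS]
          · simpa [hS, ← h i hS] using hi
      _ ≤ _ := by
          rw [← Finset.sum_union_inter]; exact Nat.le_add_right _ _
  rw [abs_sub_le_iff]
  constructor <;> rw [sub_le_iff_le_add'] <;> norm_cast
  · exact key p q h
  · exact key q p fun i hi => (h i hi).symm

/-- The positions at distance at most `1` from `a` or `b`. -/
def nearPositions {n : ℕ} (a b : Fin n) : Finset (Fin n) :=
  Finset.univ.filter fun i => ((i : ℕ) ≤ a + 1 ∧ (a : ℕ) ≤ i + 1) ∨
    ((i : ℕ) ≤ b + 1 ∧ (b : ℕ) ≤ i + 1)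

theorem card_nearPositions_le {n : ℕ} (a b : Fin n) : (nearPositions a b).card ≤ 6 := by
  have hsub : (nearPositions a b).image (fun i : Fin n => (i : ℕ)) ⊆
      Finset.Icc ((a : ℕ) - 1) (a + 1) ∪ Finset.Icc ((b : ℕ) - 1) (b + 1) := by
    intro m hm
    simp only [nearPositions, Finset.mem_image, Finset.mem_filter, Finset.mem_univ,
      true_and] at hm
    obtain ⟨i, hi, rfl⟩ := hm
    simp only [Finset.mem_union, Finset.mem_Icc]
    omega
  rw [← Finset.card_image_of_injective _ Fin.val_injective]
  refine (Finset.card_le_card hsub).trans ((Finset.card_union_le _ _).trans ?_)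
  simp only [Nat.card_Icc]
  omega

theorem mul_swap_apply_of_val_ne {n : ℕ} (σ : Perm (Fin n)) {a b i : Fin n}
    (ha : (i : ℕ) ≠ a) (hb : (i : ℕ) ≠ b) : (σ * swap a b) i = σ i := by
  rw [Perm.mul_apply, swap_apply_of_ne_of_ne (fun h => ha (by rw [h])) (fun h => hb (by rw [h]))]

/-- A transposition of `a` and `b` does not change the values at a position that is not near `a`
or `b`, nor at its neighbours. -/
theorem mul_swap_apply_of_notMem {n : ℕ} (σ : Perm (Fin n)) {a b i : Fin n}
    (h : i ∉ nearPositions a b) {m : Fin n} (h₁ : (m : ℕ) ≤ i + 1) (h₂ : (i : ℕ) ≤ m + 1) :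
    (σ * swap a b) m = σ m := by
  simp only [nearPositions, Finset.mem_filter, Finset.mem_univ, true_and] at h
  exact mul_swap_apply_of_val_ne σ (by omega) (by omega)

/-- A statistic that counts the positions with a local property moves by at most `6`. -/
theorem transpositionBounded_card_of_local
    (p : ∀ {n : ℕ}, Perm (Fin n) → Fin n → Prop) [∀ n (σ : Perm (Fin n)), DecidablePred (p σ)]
    (hp : ∀ {n : ℕ} (σ τ : Perm (Fin n)) (i : Fin n),
      (∀ m : Fin n, (m : ℕ) ≤ i + 1 → (i : ℕ) ≤ m + 1 → τ m = σ m) → (p σ i ↔ p τ i)) :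
    TranspositionBounded (fun _ σ => ((Finset.univ.filter (p σ)).card : ℝ)) := by
  refine ⟨6, fun n _ σ a b => ?_⟩
  have h := abs_sum_filter_sub_le (p σ) (p (σ * swap a b)) (fun _ => 1) (nearPositions a b)
    fun i hi => hp _ _ i fun m => mul_swap_apply_of_notMem σ hi
  rw [Real.norm_eq_abs]
  simp only [← Finset.card_eq_sum_ones] at h
  exact h.trans (by exact_mod_cast card_nearPositions_le a b)

theorem isDescent_congr {n : ℕ} (σ τ : Perm (Fin n)) (i : Fin n)
    (h : ∀ m : Fin n, (m : ℕ) ≤ i + 1 → (i : ℕ) ≤ m + 1 → τ m = σ m) :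
    IsDescent σ i ↔ IsDescent τ i := by
  refine exists_congr fun hi => ?_
  rw [h i (by omega) (by omega), h ⟨i + 1, hi⟩ (by simp) (by simp; omega)]

theorem isAscent_congr {n : ℕ} (σ τ : Perm (Fin n)) (i : Fin n)
    (h : ∀ m : Fin n, (m : ℕ) ≤ i + 1 → (i : ℕ) ≤ m + 1 → τ m = σ m) :
    IsAscent σ i ↔ IsAscent τ i := by
  refine exists_congr fun hi => ?_
  rw [h i (by omega) (by omega), h ⟨i + 1, hi⟩ (by simp) (by simp; omega)]

theorem isPeak_congr {n : ℕ} (σ τ : Perm (Fin n)) (i : Fin n)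
    (h : ∀ m : Fin n, (m : ℕ) ≤ i + 1 → (i : ℕ) ≤ m + 1 → τ m = σ m) :
    IsPeak σ i ↔ IsPeak τ i := by
  refine exists_congr fun h0 => exists_congr fun hi => ?_
  rw [h i (by omega) (by omega), h ⟨i + 1, hi⟩ (by simp) (by simp; omega),
    h ⟨i - 1, _⟩ (by simp; omega) (by simp; omega)]

theorem isValley_congr {n : ℕ} (σ τ : Perm (Fin n)) (i : Fin n)
    (h : ∀ m : Fin n, (m : ℕ) ≤ i + 1 → (i : ℕ) ≤ m + 1 → τ m = σ m) :
    IsValley σ i ↔ IsValley τ i := by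
  refine exists_congr fun h0 => exists_congr fun hi => ?_
  rw [h i (by omega) (by omega), h ⟨i + 1, hi⟩ (by simp) (by simp; omega),
    h ⟨i - 1, _⟩ (by simp; omega) (by simp; omega)]

theorem transpositionBounded_Exc : TranspositionBounded (fun _ σ => (Exc σ : ℝ)) :=
  transpositionBounded_card_of_local (fun σ i => i < σ i) fun σ τ i h => by
    rw [h i (by omega) (by omega)]

theorem transpositionBounded_Maj :
    TranspositionBounded (fun n σ => (Maj σ : ℝ) / (n : ℝ)) := by
  refine ⟨6, fun n hn σ a b => ?_⟩
  have h := abs_sum_filter_sub_le (IsAscent σ) (IsAscent (σ * swap a b)) (fun i => (i : ℕ) + 1)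
    (nearPositions a b) fun i hi => isAscent_congr _ _ i fun m => mul_swap_apply_of_notMem σ hi
  have hS : ∑ i ∈ nearPositions a b, ((i : ℕ) + 1) ≤ 6 * n :=
    (Finset.sum_le_card_nsmul _ _ n fun i _ => i.isLt).trans (by
      rw [smul_eq_mul]; exact Nat.mul_le_mul_right n (card_nearPositions_le a b))
  have hn' : (0 : ℝ) < n := by exact_mod_cast hn
  rw [Real.norm_eq_abs, ← sub_div, abs_div, abs_of_pos hn', div_le_iff₀ hn']
  exact h.trans (by exact_mod_cast hS)

theorem transpositionBounded_Inv :
    TranspositionBounded (fun n σ => (Inv σ : ℝ) / (n : ℝ)) := by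
  refine ⟨4, fun n hn σ a b => ?_⟩
  -- Only the pairs that involve position `a` or `b` are affected: two rows and two columns.
  have h := abs_sum_filter_sub_le (fun p : Fin n × Fin n => p.1 < p.2 ∧ σ p.2 < σ p.1)
    (fun p : Fin n × Fin n => p.1 < p.2 ∧ (σ * swap a b) p.2 < (σ * swap a b) p.1) (fun _ => 1)
    ((({a, b} : Finset (Fin n)) ×ˢ Finset.univ) ∪ (Finset.univ ×ˢ ({a, b} : Finset (Fin n))))
    fun p hp => by
      simp only [Finset.mem_union, Finset.mem_product, Finset.mem_insert, Finset.mem_singleton,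
        Finset.mem_univ, and_true, true_and, not_or] at hp
      rw [Perm.mul_apply, Perm.mul_apply, swap_apply_of_ne_of_ne hp.1.1 hp.1.2,
        swap_apply_of_ne_of_ne hp.2.1 hp.2.2]
  simp only [← Finset.card_eq_sum_ones] at h
  have hS : ((({a, b} : Finset (Fin n)) ×ˢ (Finset.univ : Finset (Fin n))) ∪
      (Finset.univ ×ˢ ({a, b} : Finset (Fin n)))).card ≤ 4 * n := by
    refine (Finset.card_union_le _ _).trans ?_
    simp only [Finset.card_product, Finset.card_univ, Fintype.card_fin]
    have := Nat.mul_le_mul_right n (Finset.card_le_two (a := a) (b := b))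
    rw [Nat.mul_comm n]
    omega
  have hn' : (0 : ℝ) < n := by exact_mod_cast hn
  rw [Real.norm_eq_abs, ← sub_div, abs_div, abs_of_pos hn', div_le_iff₀ hn']
  exact h.trans (by exact_mod_cast hS)

/-! ### Families of increasing subsequences -/

section Chains

variable {α : Type*} [LinearOrder α] {k : ℕ}

/-- `Chains w s m`: there are `k` disjoint weakly increasing subsequences of the word `w`, of total
length `m`, such that the letters of the subsequence `i` are at least `s i`. The word is read from
left to right; each letter is either skipped or appended to one of the subsequences, and `s`
records their current last letters (`⊥` if there is none). -/
inductive Chains : List α → (Fin k → WithBot α) → ℕ → Prop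
  | nil (s : Fin k → WithBot α) : Chains [] s 0
  | skip {a : α} {w : List α} {s : Fin k → WithBot α} {m : ℕ} (h : Chains w s m) :
      Chains (a :: w) s m
  | take {a : α} {w : List α} {s : Fin k → WithBot α} {m : ℕ} (i : Fin k) (hi : s i ≤ a)
      (h : Chains w (Function.update s i a) m) : Chains (a :: w) s (m + 1)

/-- Lowering the last letters, or permuting them, leaves at least the same possibilities. -/
theorem Chains.mono {w : List α} {s : Fin k → WithBot α} {m : ℕ} (h : Chains w s m) :
    ∀ (t : Fin k → WithBot α) (π : Perm (Fin k)), (∀ i, t i ≤ s (π i)) → Chains w t m := by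
  induction h with
  | nil s => exact fun t _ _ => .nil t
  | skip _ ih => exact fun t π ht => .skip (ih t π ht)
  | @take a w s m i hi _ ih =>
    intro t π ht
    refine .take (π.symm i) ((ht _).trans (by simpa using hi)) (ih _ π fun j => ?_)
    by_cases hj : j = π.symm i
    · subst hj; simp
    · have : π j ≠ i := fun h => hj (by simp [← h])
      simp [hj, this, ht j]

theorem Chains.anti {w : List α} {s t : Fin k → WithBot α} {m : ℕ} (h : Chains w s m)
    (ht : t ≤ s) : Chains w t m :=
  h.mono t (Equiv.refl _) ht

theorem Chains.append_left {w : List α} {s : Fin k → WithBot α} {m : ℕ} (h : Chains w s m) :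
    ∀ u : List α, Chains (u ++ w) s m
  | [] => h
  | _ :: u => .skip (h.append_left u)

/-- Changing one letter costs at most one. -/
theorem Chains.replace {x : α} (y : α) {B : List α} :
    ∀ {A : List α} {s : Fin k → WithBot α} {m : ℕ}, Chains (A ++ x :: B) s m →
      ∃ m', Chains (A ++ y :: B) s m' ∧ m ≤ m' + 1
  | [], s, m, .skip h => ⟨m, .skip h, by omega⟩
  | [], s, _, .take (m := m) i hi h => by
    refine ⟨m, .skip (h.anti fun j => ?_), le_rfl⟩
    by_cases hj : j = i
    · subst hj; simpa using hi
    · simp [hj]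
  | a :: A, s, m, .skip h => by
    obtain ⟨m', h', hm⟩ := Chains.replace y h
    exact ⟨m', .skip h', hm⟩
  | a :: A, s, _, .take i hi h => by
    obtain ⟨m', h', hm⟩ := Chains.replace y h
    exact ⟨m' + 1, .take i hi h', by omega⟩

theorem Chains.cons_iff {a : α} {w : List α} {s : Fin k → WithBot α} {m : ℕ} :
    Chains (a :: w) s m ↔ Chains w s m ∨
      ∃ i m', s i ≤ a ∧ Chains w (Function.update s i a) m' ∧ m = m' + 1 := by
  constructor
  · rintro (_ | h | ⟨i, hi, h⟩)
    · exact .inl h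
    · exact .inr ⟨i, _, hi, h, rfl⟩
  · rintro (h | ⟨i, m', hi, h, rfl⟩)
    · exact .skip h
    · exact .take i hi h

/-- Two adjacent letters may be exchanged unless both are put in the same subsequence. -/
theorem Chains.swap_head {a b : α} {w : List α} {s : Fin k → WithBot α} {m : ℕ}
    (h : Chains (a :: b :: w) s m) :
    Chains (b :: a :: w) s m ∨
      ∃ i m', s i ≤ a ∧ a ≤ b ∧ Chains w (Function.update s i b) m' ∧ m = m' + 2 := by
  obtain h₁ | ⟨i, m, hi, h₁, rfl⟩ := Chains.cons_iff.1 h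
  · obtain h₂ | ⟨j, m, hj, h₂, rfl⟩ := Chains.cons_iff.1 h₁
    · exact .inl (.skip (.skip h₂))
    · exact .inl (.take j hj (.skip h₂))
  · obtain h₂ | ⟨j, m, hj, h₂, rfl⟩ := Chains.cons_iff.1 h₁
    · exact .inl (.skip (.take i hi h₂))
    · by_cases hij : j = i
      · subst hij
        exact .inr ⟨j, m, hi, by simpa using hj, by simpa using h₂, rfl⟩
      · refine .inl (.take j (by simpa [hij] using hj)
          (.take i (by simpa [Ne.symm hij] using hi) ?_))
        rwa [Function.update_comm hij]

/-- The two words offer the same families of `k` increasing subsequences, whatever precedes and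
follows them. -/
def ChainEquiv (k : ℕ) (w w' : List α) : Prop :=
  ∀ (v : List α) (s : Fin k → WithBot α) (m : ℕ), Chains (w ++ v) s m ↔ Chains (w' ++ v) s m

theorem ChainEquiv.refl (w : List α) : ChainEquiv k w w := fun _ _ _ => Iff.rfl

theorem ChainEquiv.trans {w₁ w₂ w₃ : List α} (h : ChainEquiv k w₁ w₂) (h' : ChainEquiv k w₂ w₃) :
    ChainEquiv k w₁ w₃ := fun v s m => (h v s m).trans (h' v s m)

theorem ChainEquiv.append_right {w w' : List α} (h : ChainEquiv k w w') (v : List α) :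
    ChainEquiv k (w ++ v) (w' ++ v) := fun v' s m => by
  simpa using h (v ++ v') s m

theorem ChainEquiv.cons {w w' : List α} (h : ChainEquiv k w w') (a : α) :
    ChainEquiv k (a :: w) (a :: w') := fun v s m => by
  simp only [List.cons_append, Chains.cons_iff, h v]

theorem ChainEquiv.append_left {w w' : List α} (h : ChainEquiv k w w') :
    ∀ u : List α, ChainEquiv k (u ++ w) (u ++ w')
  | [] => h
  | a :: u => (h.append_left u).cons a

/-- The Knuth relation `y z x ~ y x z` for `x < y ≤ z`: only a subsequence that takes both `x` and
`z` obstructs the exchange, and the letter `y` can stand in for `x` there. -/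
theorem chainEquiv_knuth_left {x y z : α} (hxy : x < y) (hyz : y ≤ z) :
    ChainEquiv k [y, z, x] [y, x, z] := by
  intro v s m
  simp only [List.cons_append, List.nil_append]
  constructor
  · intro h
    obtain h₁ | ⟨i, m, hi, h₁, rfl⟩ := Chains.cons_iff.1 h <;>
      obtain h₂ | ⟨j, m, hj, hzx, -⟩ := h₁.swap_head
    · exact .skip h₂
    · exact absurd (hxy.trans_le hyz) hzx.not_gt
    · exact .take i hi h₂
    · exact absurd (hxy.trans_le hyz) hzx.not_gt
  · intro h
    obtain h₁ | ⟨i, m, hi, h₁, rfl⟩ := Chains.cons_iff.1 h <;>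
      obtain h₂ | ⟨j, m, hj, hxz, h₂, rfl⟩ := h₁.swap_head
    · exact .skip h₂
    · -- `x, z` in the subsequence `j`, `y` unused: use `y, z` instead.
      refine .take j (hj.trans (by exact_mod_cast hxy.le)) (.take j (by simpa using hyz) (.skip ?_))
      simpa using h₂
    · exact .take i hi h₂
    · -- `x, z` in the subsequence `j`, `y` in `i`: exchange the roles of the two subsequences.
      have hij : j ≠ i := by
        rintro rfl
        exact absurd hxy (by simpa using hj)
      refine .take i hi (.take i (by simpa using hyz)
        (.take j (by simpa [hij] using hj) (h₂.mono _ (Equiv.swap i j) fun l => ?_)))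
      by_cases hl : l = j
      · subst hl; simpa [Ne.symm hij] using hxy.le
      · by_cases hl' : l = i
        · subst hl'; simp [hl]
        · simp [hl, hl', swap_apply_of_ne_of_ne hl' hl]

/-- The Knuth relation `x z y ~ z x y` for `x ≤ y < z`: only a subsequence that takes both `x` and
`z` obstructs the exchange, and the letter `y` can stand in for `z` there. -/
theorem chainEquiv_knuth_right {x y z : α} (hxy : x ≤ y) (hyz : y < z) :
    ChainEquiv k [x, z, y] [z, x, y] := by
  intro v s m
  simp only [List.cons_append, List.nil_append]
  constructor
  · intro h
    obtain h₁ | ⟨i, m, hi, hxz, h₁, rfl⟩ := h.swap_head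
    · exact h₁
    · obtain h₂ | ⟨j, m, hj, h₂, rfl⟩ := Chains.cons_iff.1 h₁
      · -- `x, z` in the subsequence `i`, `y` unused: use `x, y` instead.
        refine .skip (.take i hi (.take i (by simpa using hxy) (h₂.anti fun l => ?_)))
        by_cases hl : l = i
        · subst hl; simpa using hyz.le
        · simp [hl]
      · -- `x, z` in the subsequence `i`, `y` in `j`: exchange the roles of the two subsequences.
        have hij : j ≠ i := by
          rintro rfl
          exact absurd hyz (by simpa using hj)
        have hj' : s j ≤ y := by simpa [hij] using hj
        refine .take j (hj'.trans (by exact_mod_cast hyz.le)) (.take i (by simpa [Ne.symm hij])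
          (.take i (by simpa using hxy) (h₂.mono _ (Equiv.swap i j) fun l => ?_)))
        by_cases hl : l = j
        · subst hl; simp [hij, Ne.symm hij]
        · by_cases hl' : l = i
          · subst hl'; simp
          · simp [hl, hl', swap_apply_of_ne_of_ne hl' hl]
  · intro h
    obtain h | ⟨i, m, hi, hzx, -⟩ := h.swap_head
    · exact h
    · exact absurd (hxy.trans_lt hyz) hzx.not_gt

end Chains

/-! ### Row insertion -/

section Insertion

variable {α : Type*} [LinearOrder α] {k : ℕ}

theorem head?_rowInsert (x y : α) (r : List α) :
    ∃ h r', (rowInsert x (y :: r)).1 = h :: r' ∧ h ≤ x ∧ (h = x ∨ h = y) := by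
  rw [rowInsert]
  split_ifs with hx
  exacts [⟨x, r, rfl, le_rfl, .inl rfl⟩, ⟨y, _, rfl, not_lt.1 hx, .inr rfl⟩]

theorem rowInsert_snd_eq_none {x : α} {r : List α} (h : (rowInsert x r).2 = none) :
    (rowInsert x r).1 = r ++ [x] := by
  induction r with
  | nil => rfl
  | cons a r ih =>
    rw [rowInsert] at h ⊢
    split_ifs at h ⊢ with hx
    simpa using ih h

theorem lt_of_rowInsert_snd_eq_some {x y : α} {r : List α} (h : (rowInsert x r).2 = some y) :
    x < y := by
  induction r with
  | nil => simp [rowInsert] at h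
  | cons a r ih =>
    rw [rowInsert] at h
    split_ifs at h with hx
    · simpa [← Option.some_inj.1 h] using hx
    · exact ih h

theorem mem_rowInsert {x z : α} {r : List α} (h : z ∈ (rowInsert x r).1) : z = x ∨ z ∈ r := by
  induction r with
  | nil => simpa [rowInsert] using h
  | cons a r ih =>
    rw [rowInsert] at h
    split_ifs at h with hx <;> simp only [List.mem_cons] at h ⊢
    · tauto
    · rcases h with h | h
      · tauto
      · have := ih h; tauto

theorem pairwise_le_rowInsert {x : α} {r : List α} (h : r.Pairwise (· ≤ ·)) :
    (rowInsert x r).1.Pairwise (· ≤ ·) := by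
  induction r with
  | nil => simp [rowInsert]
  | cons a r ih =>
    rw [List.pairwise_cons] at h
    rw [rowInsert]
    split_ifs with hx <;> simp only [List.pairwise_cons]
    · exact ⟨fun b hb => hx.le.trans (h.1 b hb), h.2⟩
    · refine ⟨fun b hb => ?_, ih h.2⟩
      rcases mem_rowInsert hb with rfl | hb
      exacts [not_lt.1 hx, h.1 b hb]

/-- A letter smaller than all letters of a row moves to the left through the row, up to its second
place. -/
theorem chainEquiv_move_left {x : α} {r : List α} {y : α} (hxy : x < y)
    (h : (y :: r).Pairwise (· ≤ ·)) : ChainEquiv k (y :: (r ++ [x])) (y :: x :: r) := by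
  induction r generalizing y with
  | nil => exact .refl _
  | cons z r ih =>
    have hyz : y ≤ z := (List.pairwise_cons.1 h).1 z (by simp)
    exact ((ih (hxy.trans_le hyz) (List.pairwise_cons.1 h).2).cons y).trans
      ((chainEquiv_knuth_left hxy hyz).append_right r)

/-- Inserting `x` into a row, which bumps `y`, realizes a chain of Knuth relations. -/
theorem chainEquiv_rowInsert {x y : α} {r : List α} (h : r.Pairwise (· ≤ ·))
    (hy : (rowInsert x r).2 = some y) : ChainEquiv k (r ++ [x]) (y :: (rowInsert x r).1) := by
  induction r with
  | nil => simp [rowInsert] at hy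
  | cons a r ih =>
    have hlt := lt_of_rowInsert_snd_eq_some hy
    rw [rowInsert] at hy ⊢
    split_ifs at hy ⊢ with hx
    · obtain rfl := Option.some_inj.1 hy
      exact chainEquiv_move_left hx h
    · rw [List.pairwise_cons] at h
      refine ((ih h.2 hy).cons a).trans ?_
      cases r with
      | nil => simp [rowInsert] at hy
      | cons b r =>
        obtain ⟨c, r', hr', hcx, hc⟩ := head?_rowInsert x b r
        rw [hr']
        refine (chainEquiv_knuth_right ?_ ?_).append_right r'
        · rcases hc with rfl | rfl
          exacts [not_lt.1 hx, h.1 _ (by simp)]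
        · exact hcx.trans_lt (lt_of_rowInsert_snd_eq_some hy)

/-! ### Tableaux -/

/-- `Above r r'`: the row `r'` is not longer than `r`, and each of its entries is larger than the
entry of `r` in the same column. -/
inductive Above : List α → List α → Prop
  | nil (r : List α) : Above r []
  | cons {a b : α} {r r' : List α} (h : a < b) (h' : Above r r') : Above (a :: r) (b :: r')

theorem Above.getElem? {r r' : List α} (h : Above r r') {c : ℕ} {b : α} (hb : r'[c]? = some b) :
    ∃ a, r[c]? = some a ∧ a < b := by
  induction h generalizing c with
  | nil => simp at hb
  | @cons a b' r r' h _ ih =>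
    cases c with
    | zero => exact ⟨a, by simp, by simpa [← Option.some_inj.1 hb] using h⟩
    | succ c => simpa using ih (by simpa using hb)

theorem Above.trans {r₁ r₂ r₃ : List α} (h : Above r₁ r₂) (h' : Above r₂ r₃) : Above r₁ r₃ := by
  induction h' generalizing r₁ with
  | nil => exact .nil _
  | cons hab _ ih =>
    cases h with
    | cons h₁ h₂ => exact .cons (h₁.trans hab) (ih h₂)

instance : IsTrans (List α) Above := ⟨fun _ _ _ => Above.trans⟩

/-- Row insertion only lowers entries or appends one. -/
theorem Above.rowInsert_left {r r' : List α} (h : Above r r') (x : α) :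
    Above (rowInsert x r).1 r' := by
  induction h with
  | nil => exact .nil _
  | cons hab h ih =>
    rw [rowInsert]
    split_ifs with hx
    exacts [.cons (hx.trans hab) h, .cons hab ih]

/-- An entry that is bumped from a row is inserted in the next row weakly to the left. -/
theorem Above.rowInsert {x y : α} {r r' : List α} (h : Above r r')
    (hy : (rowInsert x r).2 = some y) : Above (rowInsert x r).1 (rowInsert y r').1 := by
  induction r generalizing r' with
  | nil => simp [PermStat.rowInsert] at hy
  | cons a r ih =>
    have hxy := lt_of_rowInsert_snd_eq_some hy
    rw [PermStat.rowInsert] at hy ⊢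
    split_ifs at hy ⊢ with hx
    · obtain rfl := Option.some_inj.1 hy
      cases h with
      | nil => exact .cons hx (.nil _)
      | cons hab h => simpa [PermStat.rowInsert, hab] using .cons hx h
    · have hay : a < y := (not_lt.1 hx).trans_lt hxy
      cases h with
      | nil => exact .cons hay (.nil _)
      | cons hab h =>
        rw [PermStat.rowInsert]
        split_ifs
        · exact .cons hay (h.rowInsert_left x)
        · exact .cons hab (ih h hy)

/-- Semistandard tableaux: the rows increase weakly and the columns increase strictly. -/
def IsTableau (T : List (List α)) : Prop :=
  (∀ r ∈ T, r.Pairwise (· ≤ ·)) ∧ T.Pairwise Above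

theorem tableauInsert_cons_of_none {r : List α} {T : List (List α)} {x : α}
    (h : (rowInsert x r).2 = none) : tableauInsert (r :: T) x = (rowInsert x r).1 :: T := by
  rw [tableauInsert]
  generalize rowInsert x r = p at h ⊢
  obtain ⟨r', o⟩ := p
  subst h
  rfl

theorem tableauInsert_cons_of_some {r : List α} {T : List (List α)} {x y : α}
    (h : (rowInsert x r).2 = some y) :
    tableauInsert (r :: T) x = (rowInsert x r).1 :: tableauInsert T y := by
  rw [tableauInsert]
  generalize rowInsert x r = p at h ⊢
  obtain ⟨r', o⟩ := p
  subst h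
  rfl

theorem isTableau_cons_cons {r r' : List α} {T : List (List α)} :
    IsTableau (r :: r' :: T) ↔ r.Pairwise (· ≤ ·) ∧ Above r r' ∧ IsTableau (r' :: T) := by
  simp only [IsTableau, ← List.isChain_iff_pairwise, List.isChain_cons_cons, List.mem_cons,
    forall_eq_or_imp]
  tauto

theorem IsTableau.of_cons {r : List α} {T : List (List α)} (h : IsTableau (r :: T)) :
    IsTableau T :=
  ⟨fun r' hr' => h.1 r' (by simp [hr']), (List.pairwise_cons.1 h.2).2⟩

theorem IsTableau.tableauInsert {T : List (List α)} (h : IsTableau T) (x : α) :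
    IsTableau (tableauInsert T x) := by
  induction T generalizing x with
  | nil => simp [IsTableau, PermStat.tableauInsert]
  | cons r T ih =>
    have hr : (PermStat.rowInsert x r).1.Pairwise (· ≤ ·) := pairwise_le_rowInsert (h.1 r (by simp))
    cases hy : (PermStat.rowInsert x r).2 with
    | none =>
      rw [tableauInsert_cons_of_none hy]
      cases T with
      | nil => simpa [IsTableau] using hr
      | cons r' T =>
        rw [isTableau_cons_cons] at h ⊢
        exact ⟨hr, h.2.1.rowInsert_left x, h.2.2⟩
    | some y =>
      have hT := ih h.of_cons y
      rw [tableauInsert_cons_of_some hy]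
      cases T with
      | nil => exact isTableau_cons_cons.2 ⟨hr, (Above.nil r).rowInsert hy, hT⟩
      | cons r' T =>
        have ha := (isTableau_cons_cons.1 h).2.1.rowInsert hy
        cases hz : (PermStat.rowInsert y r').2 with
        | none =>
          rw [tableauInsert_cons_of_none hz] at hT ⊢
          exact isTableau_cons_cons.2 ⟨hr, ha, hT⟩
        | some z =>
          rw [tableauInsert_cons_of_some hz] at hT ⊢
          exact isTableau_cons_cons.2 ⟨hr, ha, hT⟩

/-- The row reading word of a tableau: its rows, from the last one to the first one. -/
def readingWord : List (List α) → List α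
  | [] => []
  | r :: T => readingWord T ++ r

theorem chainEquiv_tableauInsert {T : List (List α)} (h : IsTableau T) (x : α) :
    ChainEquiv k (readingWord T ++ [x]) (readingWord (tableauInsert T x)) := by
  induction T generalizing x with
  | nil => exact .refl _
  | cons r T ih =>
    cases hy : (rowInsert x r).2 with
    | none =>
      rw [tableauInsert_cons_of_none hy, readingWord, readingWord, rowInsert_snd_eq_none hy,
        List.append_assoc]
      exact .refl _
    | some y =>
      rw [tableauInsert_cons_of_some hy, readingWord, readingWord, List.append_assoc]
      refine ((chainEquiv_rowInsert (h.1 r (by simp)) hy).append_left _).trans ?_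
      simpa using (ih h.of_cons y).append_right (rowInsert x r).1

/-- A word and the reading word of its insertion tableau contain families of increasing
subsequences of the same total lengths. -/
theorem chainEquiv_foldl_tableauInsert (w : List α) {T : List (List α)} (h : IsTableau T) :
    ChainEquiv k (readingWord T ++ w) (readingWord (w.foldl tableauInsert T)) := by
  induction w generalizing T with
  | nil => simpa using ChainEquiv.refl _
  | cons x w ih =>
    simpa using ((chainEquiv_tableauInsert h x).append_right w).trans (ih (h.tableauInsert x))

theorem IsTableau.foldl_tableauInsert (w : List α) {T : List (List α)} (h : IsTableau T) :
    IsTableau (w.foldl PermStat.tableauInsert T) := by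
  induction w generalizing T with
  | nil => exact h
  | cons x w ih => exact ih (h.tableauInsert x)

/-! ### Increasing subsequences of the reading word of a tableau -/

/-- The total length of the first `j` rows. -/
def rowSum (T : List (List α)) (j : ℕ) : ℕ := ∑ i ∈ Finset.range j, (T.getD i []).length

theorem rowSum_nil {β : Type*} (j : ℕ) : rowSum ([] : List (List β)) j = 0 := by simp [rowSum]

theorem rowSum_zero {β : Type*} (T : List (List β)) : rowSum T 0 = 0 := by simp [rowSum]

theorem rowSum_cons_succ {β : Type*} (r : List β) (T : List (List β)) (j : ℕ) :
    rowSum (r :: T) (j + 1) = r.length + rowSum T j := by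
  rw [rowSum, Finset.sum_range_succ', add_comm]
  rfl

theorem Chains.append_row {r v : List α} {m : ℕ} (i : Fin k) (hr : r.Pairwise (· ≤ ·))
    {s : Fin k → WithBot α} (hs : ∀ a ∈ r, s i ≤ a)
    (hv : ∀ b, Chains v (Function.update s i b) m) : Chains (r ++ v) s (r.length + m) := by
  induction r generalizing s with
  | nil => simpa using hv (s i)
  | cons a r ih =>
    rw [List.pairwise_cons] at hr
    rw [List.length_cons, Nat.add_right_comm]
    exact .take i (hs a (by simp))
      (ih hr.2 (by simpa using hr.1) fun b => by simpa using hv b)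

/-- The first `j` rows are increasing subsequences of the reading word. Whatever follows is read with
the subsequences of index at least `j` unchanged. -/
theorem IsTableau.chains_readingWord {T : List (List α)} (h : IsTableau T) {j : ℕ} (hj : j ≤ k)
    {v : List α} {m : ℕ} {s : Fin k → WithBot α} (hs : ∀ i, s i = ⊥)
    (hv : ∀ t : Fin k → WithBot α, (∀ i : Fin k, j ≤ i → t i = ⊥) → Chains v t m) :
    Chains (readingWord T ++ v) s (rowSum T j + m) := by
  induction T generalizing j v m with
  | nil => simpa [rowSum_nil] using (hv s fun i _ => hs i).append_left _
  | cons r T ih =>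
    cases j with
    | zero => simpa [rowSum_zero] using (hv s fun i _ => hs i).append_left _
    | succ j =>
      rw [rowSum_cons_succ, readingWord, List.append_assoc, add_comm r.length, add_assoc]
      refine ih h.of_cons (by omega) fun t ht => ?_
      refine Chains.append_row ⟨j, hj⟩ (h.1 r (by simp)) (by simp [ht ⟨j, hj⟩ le_rfl])
        fun b => hv _ fun i hi => ?_
      have : i ≠ ⟨j, hj⟩ := fun h => by simp [h] at hi
      simpa [this] using ht i (by omega)

/-- If the letters of a word are coloured so that the letters of each colour decrease, then each of
`k` increasing subsequences contains at most one letter of each colour. In the induction, a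
subsequence with last letter `s i` counts for the colour `c` as long as a letter of colour `c` that
it might still take remains. -/
theorem Chains.le_sum_min {w : List (ℕ × α)}
    (hw : w.Pairwise fun p q => p.1 = q.1 → q.2 < p.2) {N : ℕ} (hN : ∀ p ∈ w, p.1 < N)
    {s : Fin k → WithBot α} {m : ℕ} (h : Chains (w.map Prod.snd) s m) :
    m ≤ ∑ c ∈ Finset.range N, min (w.countP (·.1 = c))
      (Finset.univ.filter fun i => ∃ p ∈ w, p.1 = c ∧ s i ≤ p.2).card := by
  induction w generalizing s m with
  | nil => cases h; simp
  | cons p w ih =>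
    rw [List.pairwise_cons] at hw
    replace ih : ∀ {s : Fin k → WithBot α} {m : ℕ}, Chains (w.map Prod.snd) s m → _ :=
      fun h => ih hw.2 (fun q hq => hN q (List.mem_cons_of_mem p hq)) h
    have hcount : ∀ c, w.countP (·.1 = c) ≤ (p :: w).countP (·.1 = c) := fun c =>
      (List.sublist_cons_self p w).countP_le
    obtain h₁ | ⟨i, m, hi, h₁, rfl⟩ := Chains.cons_iff.1 h
    · refine (ih h₁).trans (Finset.sum_le_sum fun c _ => min_le_min (hcount c)
        (Finset.card_le_card fun l => ?_))
      simp only [Finset.mem_filter, Finset.mem_univ, true_and]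
      exact fun ⟨q, hq, hqc⟩ => ⟨q, List.mem_cons_of_mem p hq, hqc⟩
    · have hsub : ∀ c, (Finset.univ.filter fun l => ∃ q ∈ w, q.1 = c ∧
          Function.update s i p.2 l ≤ q.2) ⊆
          Finset.univ.filter fun l => ∃ q ∈ p :: w, q.1 = c ∧ s l ≤ q.2 := by
        intro c l
        simp only [Finset.mem_filter, Finset.mem_univ, true_and]
        rintro ⟨q, hq, hqc, hl⟩
        refine ⟨q, List.mem_cons_of_mem p hq, hqc, ?_⟩
        by_cases hli : l = i
        · subst hli
          exact hi.trans (by simpa using hl)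
        · simpa [hli] using hl
      refine Nat.succ_le_of_lt ((ih h₁).trans_lt (Finset.sum_lt_sum
        (fun c _ => min_le_min (hcount c) (Finset.card_le_card (hsub c)))
        ⟨p.1, Finset.mem_range.2 (hN p (by simp)), min_lt_min (by simp) (Finset.card_lt_card ?_)⟩))
      refine (Finset.ssubset_iff_of_subset (hsub p.1)).2 ⟨i, ?_, ?_⟩
      · simpa using .inl hi
      · simp only [Finset.mem_filter, Finset.mem_univ, true_and, Function.update_self]
        rintro ⟨q, hq, hqc, hl⟩
        exact absurd (hw.1 q hq hqc.symm) (by simpa using hl)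

/-- The row reading word, each entry being paired with the index of its column. -/
def readingWordCols : List (List α) → List (ℕ × α)
  | [] => []
  | r :: T => readingWordCols T ++ r.zipIdx.map Prod.swap

theorem map_snd_readingWordCols {β : Type*} (T : List (List β)) :
    (readingWordCols T).map Prod.snd = readingWord T := by
  induction T with
  | nil => rfl
  | cons r T ih => simp [readingWordCols, readingWord, ih, Function.comp_def]

theorem mem_zipIdx_map_swap {β : Type*} {r : List β} {p : ℕ × β} :
    p ∈ r.zipIdx.map Prod.swap ↔ r[p.1]? = some p.2 := by
  obtain ⟨c, a⟩ := p
  simp [List.mem_zipIdx_iff_getElem?]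

theorem exists_of_mem_readingWordCols {β : Type*} {T : List (List β)} {p : ℕ × β}
    (h : p ∈ readingWordCols T) : ∃ r ∈ T, r[p.1]? = some p.2 := by
  induction T with
  | nil => simp [readingWordCols] at h
  | cons r T ih =>
    rw [readingWordCols, List.mem_append, mem_zipIdx_map_swap] at h
    rcases h with h | h
    · obtain ⟨r', hr', h⟩ := ih h
      exact ⟨r', by simp [hr'], h⟩
    · exact ⟨r, by simp, h⟩

/-- In the reading word of a tableau, the entries of each column decrease. -/
theorem IsTableau.pairwise_readingWordCols {T : List (List α)} (h : IsTableau T) :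
    (readingWordCols T).Pairwise fun p q => p.1 = q.1 → q.2 < p.2 := by
  induction T with
  | nil => simp [readingWordCols]
  | cons r T ih =>
    rw [readingWordCols, List.pairwise_append]
    refine ⟨ih h.of_cons, ?_, fun p hp q hq hpq => ?_⟩
    · have hnd : (r.zipIdx.map Prod.snd).Nodup := by
        rw [List.zipIdx_map_snd]; exact List.nodup_range'
      rw [List.pairwise_map]
      exact (List.pairwise_map.1 hnd).imp fun hne heq => absurd heq hne
    · obtain ⟨r', hr', hp⟩ := exists_of_mem_readingWordCols hp
      obtain ⟨a, ha, hlt⟩ := ((List.pairwise_cons.1 h.2).1 r' hr').getElem? hp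
      rw [mem_zipIdx_map_swap, ← hpq, ha] at hq
      rwa [← Option.some_inj.1 hq]

theorem countP_zipIdx_map_swap {β : Type*} (r : List β) (c : ℕ) :
    (r.zipIdx.map Prod.swap).countP (·.1 = c) = if c < r.length then 1 else 0 := by
  have : (r.zipIdx.map Prod.swap).countP (·.1 = c) = (r.zipIdx.map Prod.snd).count c := by
    rw [List.count, List.countP_map, List.countP_map]
    refine List.countP_congr fun p _ => by simp
  rw [this, List.zipIdx_map_snd, List.Nodup.count List.nodup_range']
  simp

theorem IsTableau.sum_min_countP_le {T : List (List α)} (h : IsTableau T) (N j : ℕ) :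
    ∑ c ∈ Finset.range N, min ((readingWordCols T).countP (·.1 = c)) j ≤ rowSum T j := by
  induction T generalizing j with
  | nil => simp [readingWordCols]
  | cons r T ih =>
    cases j with
    | zero => simp
    | succ j =>
      have hle : ∀ c ∈ Finset.range N, min ((readingWordCols (r :: T)).countP (·.1 = c)) (j + 1) ≤
          (if c < r.length then 1 else 0) + min ((readingWordCols T).countP (·.1 = c)) j := by
        intro c _
        rw [readingWordCols, List.countP_append, countP_zipIdx_map_swap]
        split_ifs with hc
        · omega
        · -- No row is longer than the first one.
          have h0 : (readingWordCols T).countP (·.1 = c) = 0 := by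
            rw [List.countP_eq_zero]
            rintro ⟨c', b⟩ hp hpc
            obtain rfl : c' = c := by simpa using hpc
            obtain ⟨r', hr', hp⟩ := exists_of_mem_readingWordCols hp
            obtain ⟨a, ha, -⟩ := ((List.pairwise_cons.1 h.2).1 r' hr').getElem? hp
            exact hc (List.getElem?_eq_some_iff.1 ha).1
          omega
      refine (Finset.sum_le_sum hle).trans ?_
      rw [Finset.sum_add_distrib, rowSum_cons_succ]
      refine Nat.add_le_add ?_ (ih h.of_cons j)
      rw [Finset.sum_boole, Nat.cast_id]
      refine (Finset.card_le_card fun c hc => ?_).trans_eq (Finset.card_range r.length)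
      simpa using (Finset.mem_filter.1 hc).2

theorem IsTableau.le_rowSum_of_chains {T : List (List α)} (h : IsTableau T)
    {s : Fin k → WithBot α} {m : ℕ} (hm : Chains (readingWord T) s m) : m ≤ rowSum T k := by
  rw [← map_snd_readingWordCols] at hm
  obtain ⟨N, hN⟩ := ((readingWordCols T).map Prod.fst).toFinset.exists_nat_subset_range
  refine (hm.le_sum_min h.pairwise_readingWordCols (N := N) fun p hp => ?_).trans
    ((Finset.sum_le_sum fun c _ => min_le_min le_rfl ?_).trans (h.sum_min_countP_le N k))
  · exact Finset.mem_range.1 (hN (by simpa using ⟨p.2, hp⟩))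
  · exact (Finset.card_le_univ _).trans_eq (Fintype.card_fin k)

/-- Greene's theorem: the first `k` rows of the insertion tableau of a word have the largest
total length of `k` disjoint weakly increasing subsequences of this word. -/
theorem isGreatest_rowSum (k : ℕ) (w : List α) :
    IsGreatest {m | Chains w (fun _ : Fin k => ⊥) m} (rowSum (w.foldl tableauInsert []) k) := by
  have h0 : IsTableau ([] : List (List α)) := by simp [IsTableau]
  have hT := h0.foldl_tableauInsert w
  have he : ∀ m, Chains w (fun _ : Fin k => ⊥) m ↔
      Chains (readingWord (w.foldl tableauInsert [])) (fun _ : Fin k => ⊥) m := fun m => by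
    simpa [readingWord] using chainEquiv_foldl_tableauInsert w h0 [] (fun _ : Fin k => ⊥) m
  constructor
  · refine (he _).2 ?_
    simpa using hT.chains_readingWord (v := []) (m := 0) le_rfl (fun _ => rfl) fun t _ => .nil t
  · exact fun m hm => hT.le_rowSum_of_chains ((he m).1 hm)

end Insertion

/-! ### Row lengths under a transposition -/

theorem abs_rowSum_sub_le {α : Type*} [LinearOrder α] (k : ℕ) (A : List α) (x y : α)
    (B : List α) :
    |(rowSum ((A ++ x :: B).foldl tableauInsert []) k : ℝ) -
      rowSum ((A ++ y :: B).foldl tableauInsert []) k| ≤ 1 := by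
  have key : ∀ x y : α, rowSum ((A ++ x :: B).foldl tableauInsert []) k ≤
      rowSum ((A ++ y :: B).foldl tableauInsert []) k + 1 := by
    intro x y
    obtain ⟨m, hm, hle⟩ := Chains.replace y (isGreatest_rowSum k (A ++ x :: B)).1
    exact hle.trans (Nat.add_le_add_right ((isGreatest_rowSum k _).2 hm) 1)
  rw [abs_sub_le_iff]
  constructor <;> rw [sub_le_iff_le_add'] <;> exact_mod_cast key _ _

theorem abs_rskRow_sub_le {n : ℕ} (σ : Perm (Fin n)) (a b : Fin n) (i : ℕ) :
    |(rskRow σ i : ℝ) - rskRow (σ * swap a b) i| ≤ 4 := by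
  have hrow : ∀ τ : Perm (Fin n), (rskRow τ i : ℝ) =
      rowSum (insertionTableau τ) (i + 1) - rowSum (insertionTableau τ) i := fun τ => by
    rw [rowSum, rowSum, Finset.sum_range_succ, Nat.cast_add, add_sub_cancel_left]
    rfl
  have h : ∀ k, |(rowSum (insertionTableau σ) k : ℝ) -
      rowSum (insertionTableau (σ * swap a b)) k| ≤ 2 * 1 := fun k =>
    abs_sub_mul_swap_le (f := fun w => (rowSum (w.foldl tableauInsert []) k : ℝ))
      (abs_rowSum_sub_le k) σ a b
  have h₁ := abs_le.1 (h i)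
  have h₂ := abs_le.1 (h (i + 1))
  rw [hrow, hrow, abs_le]
  constructor <;> linarith

theorem transpositionBounded_rskRows (d : ℕ) :
    TranspositionBounded (fun _ σ => rskRows d σ) := by
  refine ⟨√(d * 4 ^ 2), fun n _ σ a b => ?_⟩
  rw [EuclideanSpace.norm_eq]
  refine Real.sqrt_le_sqrt ?_
  calc _ ≤ ∑ _i : Fin d, (4 : ℝ) ^ 2 := Finset.sum_le_sum fun i _ =>
        pow_le_pow_left₀ (norm_nonneg _) (abs_rskRow_sub_le σ a b i) 2
    _ = d * 4 ^ 2 := by simp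

end PermStat

theorem mainTheorem4 :
    PermStat.TranspositionBounded (fun _ σ => (PermStat.LIS σ : ℝ)) ∧
    PermStat.TranspositionBounded (fun _ σ => (PermStat.LDS σ : ℝ)) ∧
    (∀ d : ℕ, PermStat.TranspositionBounded (fun _ σ => PermStat.rskRows d σ)) ∧
    PermStat.TranspositionBounded (fun n σ => (PermStat.Inv σ : ℝ) / (n : ℝ)) ∧
    PermStat.TranspositionBounded (fun _ σ => (PermStat.Des σ : ℝ)) ∧
    PermStat.TranspositionBounded (fun _ σ => (PermStat.Asc σ : ℝ)) ∧
    PermStat.TranspositionBounded (fun _ σ => (PermStat.Peaks σ : ℝ)) ∧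
    PermStat.TranspositionBounded (fun _ σ => (PermStat.Valleys σ : ℝ)) ∧
    PermStat.TranspositionBounded (fun _ σ => (PermStat.Exc σ : ℝ)) ∧
    PermStat.TranspositionBounded (fun n σ => (PermStat.Maj σ : ℝ) / (n : ℝ)) ∧
    PermStat.TranspositionBounded (fun _ σ => (PermStat.LAS σ : ℝ)) :=
  ⟨PermStat.transpositionBounded_LIS, PermStat.transpositionBounded_LDS,
    PermStat.transpositionBounded_rskRows, PermStat.transpositionBounded_Inv,
    PermStat.transpositionBounded_card_of_local PermStat.IsDescent PermStat.isDescent_congr,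
    PermStat.transpositionBounded_card_of_local PermStat.IsAscent PermStat.isAscent_congr,
    PermStat.transpositionBounded_card_of_local PermStat.IsPeak PermStat.isPeak_congr,
    PermStat.transpositionBounded_card_of_local PermStat.IsValley PermStat.isValley_congr,
    PermStat.transpositionBounded_Exc, PermStat.transpositionBounded_Maj,
    PermStat.transpositionBounded_LAS⟩
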